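/- Let $n,m\ge 1$ be integers, let $\mathbb I=[0,1]$, and let $\Psi:\mathbb{Z}^n\setminus\{\mathbf 0\}\to[0,\infty)$ be any function. For $k>0$ let $\mathcal C^{\times}_{n,m}(k\Psi)$ be the set of all $(\mathbf X^{(1)},\dots,\mathbf X^{(m)})\in(\mathbb I^{n})^m=\mathbb I^{nm}$ for which $$\prod_{j=1}^m\bigl|\mathbf q\cdot\mathbf X^{(j)}+p_j\bigr|<k\Psi(\mathbf q)$$ holds for infinitely many pairs $(\mathbf q,\mathbf p)$ with $\mathbf q=(q_1,\dots,q_n)\in\mathbb Z^n\setminus\{\mathbf 0\}$, $\mathbf p=(p_1,\dots,p_m)\in\mathbb Z^m$ and $\gcd(q_1,\dots,q_n,p_1,\dots,p_m)=1$. Then the $nm$-dimensional Lebesgue measure of $\mathcal C^{\times}_{n,m}(k\Psi)$ is $0$ or $1$ for every real $k>0$, and its value does not depend on $k>0$. -/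

import Mathlib

/-- Integer vectors `q`, `p` (possibly of different dimensions) are globally coprime if the
greatest common divisor of all of their components together is `1`. -/
def GloballyCoprime {n m : ℕ} (q : Fin n → ℤ) (p : Fin m → ℤ) : Prop :=
  Int.gcd (Finset.univ.gcd q) (Finset.univ.gcd p) = 1

/-- The multiplicative set of all `X = (X 0, …, X (m - 1))` in the cube `[0,1]^{nm}`, where each
`X j` is a point of `[0,1]^n`, such that `∏ j, |q · X j + p j| < Ψ q` holds for infinitely many
pairs `(q, p)` of globally coprime vectors `q ∈ ℤ^n ∖ {0}` and `p ∈ ℤ^m`. -/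
def multiplicativeSetC (n m : ℕ) (Ψ : {q : Fin n → ℤ // q ≠ 0} → ℝ) :
    Set (Fin m → Fin n → ℝ) :=
  {X | (∀ j i, X j i ∈ Set.Icc (0 : ℝ) 1) ∧
    {qp : {q : Fin n → ℤ // q ≠ 0} × (Fin m → ℤ) |
      GloballyCoprime qp.1.1 qp.2 ∧
        ∏ j, |(∑ i, (qp.1.1 i : ℝ) * X j i) + (qp.2 j : ℝ)| < Ψ qp.1}.Infinite}

/-! Fix all but one of the `m` vectors. For almost every choice none of their forms `q · X + p`
vanishes, so dividing by the other factors turns the inequality into `|q · y + a| < k * r i`, where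
`i` records `q` and the remaining `p`, and `a` must be coprime to `q` and the gcd `g` of those `p`.
The fibre is thus a limsup set of thickened hyperplanes (`mem_multiplicativeLimsup_iff`).

If `r i / ‖q‖₁ → 0`, Cassels' scaling lemma makes the fibre independent of `k` up to null sets, and
a Gallagher-type argument on the torus makes it null or full
(`eventuallyConst_preimage_limsupStrip`): for each prime `l` the indices split according to
divisibility by `l`, and each piece is stable under an expanding affine map or under `l`-torsion
translations. Otherwise `r i ≥ ε ‖q‖₁` with `‖q‖₁` arbitrarily large; gaps between integers coprime
to `d` are `o(d)`, so the strips cover everything (`limsupStrip_eq_univ_of_not_tendsto`).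

Fubini then passes from fibres to the cube: a zero-one law in each variable gives one for the
product (`measure_pi_eq_zero_or_one_of_update`), and integrating fibre measures removes the
dependence on `k`. -/

open MeasureTheory Filter Set
open scoped Topology

/-! ### Zero-one criteria on the torus. -/

section Torus

variable {n : ℕ}

theorem aeconst_of_dense_setOf_preimage_add_left_ae {G : Type*} [AddCommGroup G]
    [TopologicalSpace G] [IsTopologicalAddGroup G] [R1Space G] [MeasurableSpace G] [BorelSpace G]
    [SecondCountableTopology G] {μ : Measure G} [IsFiniteMeasure μ] [μ.InnerRegular]
    [μ.IsAddLeftInvariant] {F : Set G} (hF : NullMeasurableSet F μ)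
    (hd : Dense {u : G | (u + ·) ⁻¹' F =ᵐ[μ] F}) : EventuallyConst F (ae μ) :=
  aeconst_of_dense_setOfPred_preimage_vadd_ae hF hd

/-- The measurable section of the covering `ℝⁿ → ℝⁿ / ℤⁿ` with values in `(0, 1]ⁿ`. -/
noncomputable def torusSection (n : ℕ) (t : UnitAddTorus (Fin n)) : Fin n → ℝ :=
  fun i => (AddCircle.equivIoc 1 0 (t i) : ℝ)

theorem coe_torusSection (t : UnitAddTorus (Fin n)) (i : Fin n) :
    ((torusSection n t i : ℝ) : UnitAddCircle) = t i :=
  (AddCircle.equivIoc 1 0).symm_apply_apply (t i)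

theorem measurePreserving_torusSection :
    MeasurePreserving (torusSection n) volume
      (Measure.pi fun _ : Fin n => volume.restrict (Ioc (0 : ℝ) 1)) := by
  refine measurePreserving_pi (fun _ => volume) _ (f := fun _ x => (AddCircle.equivIoc (1 : ℝ) 0 x : ℝ))
    fun i => ?_
  have h := measurePreserving_subtype_coe (μa := (volume : Measure ℝ))
    (measurableSet_Ioc (a := (0 : ℝ)) (b := 0 + 1))
  have := h.comp (AddCircle.measurePreserving_equivIoc (T := 1) (a := 0))
  simpa [Function.comp_def] using this

theorem dense_setOf_nsmul_eq_zero_of_unbounded (S : Set ℕ) (hS : ∀ N, ∃ k ∈ S, N ≤ k) :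
    Dense {u : UnitAddTorus (Fin n) | ∃ k ∈ S, k • u = 0} := by
  intro t
  rw [Metric.mem_closure_iff]
  intro ε hε
  obtain ⟨N, hN⟩ := exists_nat_gt (1 / ε)
  obtain ⟨k, hkS, hk⟩ := hS (N + 1)
  have hk0 : (0 : ℝ) < k := by exact_mod_cast (by omega : 0 < k)
  refine ⟨fun i => ((⌊k * torusSection n t i⌋ / k : ℝ) : UnitAddCircle), ⟨k, hkS, ?_⟩, ?_⟩
  · funext i
    have : (k • ((⌊k * torusSection n t i⌋ / k : ℝ) : UnitAddCircle)) =
        ((⌊k * torusSection n t i⌋ : ℤ) • (1 : ℝ) : ℝ) := by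
      rw [← AddCircle.coe_nsmul]
      congr 1
      simp
      field_simp
    change k • ((⌊k * torusSection n t i⌋ / k : ℝ) : UnitAddCircle) = 0
    rw [this, AddCircle.coe_zsmul, AddCircle.coe_period, smul_zero]
  · rw [dist_pi_lt_iff hε]
    intro i
    rw [← coe_torusSection t i, dist_eq_norm, ← AddCircle.coe_sub]
    refine lt_of_le_of_lt (QuotientAddGroup.norm_mk_le_norm) ?_
    have h1 := Int.floor_le (k * torusSection n t i)
    have h2 := Int.lt_floor_add_one (k * torusSection n t i)
    rw [show torusSection n t i - (⌊k * torusSection n t i⌋ / k : ℝ) =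
      (k * torusSection n t i - ⌊k * torusSection n t i⌋) / k by field_simp]
    rw [Real.norm_eq_abs, abs_of_nonneg (div_nonneg (by linarith) hk0.le), div_lt_iff₀ hk0]
    have h3 : (1 : ℝ) < ε * k := by
      rw [div_lt_iff₀ hε] at hN
      have : (N : ℝ) ≤ k := by exact_mod_cast (by omega : N ≤ k)
      nlinarith
    linarith

theorem eventuallyConst_of_forall_torsion_vadd {F : Set (UnitAddTorus (Fin n))}
    (hF : NullMeasurableSet F) (S : Set ℕ) (hS : ∀ N, ∃ k ∈ S, N ≤ k)
    (h : ∀ k ∈ S, ∀ u : UnitAddTorus (Fin n), k • u = 0 → (u + ·) ⁻¹' F =ᵐ[volume] F) :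
    EventuallyConst F (ae volume) := by
  have : (volume : Measure (UnitAddTorus (Fin n))).IsAddHaarMeasure :=
    inferInstanceAs (Measure.IsAddHaarMeasure (Measure.pi fun _ => volume))
  refine aeconst_of_dense_setOf_preimage_add_left_ae hF ?_
  refine (dense_setOf_nsmul_eq_zero_of_unbounded S hS).mono ?_
  rintro u ⟨k, hk, hu⟩
  exact h k hk u hu

theorem measurePreserving_nsmul_add (k : ℕ) (hk : k ≠ 0) (u : UnitAddTorus (Fin n)) :
    MeasurePreserving (fun t : UnitAddTorus (Fin n) => k • t + u) volume volume := by
  have : (volume : Measure (UnitAddTorus (Fin n))).IsAddHaarMeasure :=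
    inferInstanceAs (Measure.IsAddHaarMeasure (Measure.pi fun _ => volume))
  have h1 : MeasurePreserving (fun t : UnitAddTorus (Fin n) => k • t) volume volume := by
    refine (nsmulAddMonoidHom k : UnitAddTorus (Fin n) →+ _).measurePreserving
      (continuous_nsmul k) (fun t => ?_) (by simp)
    have hk0 : (k : ℝ) ≠ 0 := by exact_mod_cast hk
    refine ⟨fun i => ((torusSection n t i / k : ℝ) : UnitAddCircle), funext fun i => ?_⟩
    simp only [nsmulAddMonoidHom_apply, Pi.smul_apply]
    rw [← AddCircle.coe_nsmul, ← coe_torusSection t i]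
    congr 1
    simp
    field_simp
  exact (measurePreserving_add_right volume u).comp h1

/-- The map preserves a finite measure, so the inclusion is an a.e. equality and `F` agrees a.e.
with its preimage under the `N`-th iterate. That preimage is exactly invariant under `k ^
N`-torsion, and such torsion points are dense as `N` varies. -/
theorem eventuallyConst_of_ae_subset_preimage_nsmul_add {F : Set (UnitAddTorus (Fin n))}
    (hF : MeasurableSet F) {k : ℕ} (hk : 2 ≤ k) (u : UnitAddTorus (Fin n))
    (h : F ≤ᵐ[volume] (fun t => k • t + u) ⁻¹' F) :
    EventuallyConst F (ae volume) := by
  set T : UnitAddTorus (Fin n) → UnitAddTorus (Fin n) := fun t => k • t + u with hT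
  have hmp : MeasurePreserving T volume volume := measurePreserving_nsmul_add k (by omega) u
  have heq : T ⁻¹' F =ᵐ[volume] F :=
    (ae_eq_of_ae_subset_of_measure_ge h (hmp.measure_preimage hF.nullMeasurableSet).le
      hF.nullMeasurableSet (measure_ne_top _ _)).symm
  refine eventuallyConst_of_forall_torsion_vadd hF.nullMeasurableSet (range fun N => k ^ N)
    (fun N => ⟨k ^ N, ⟨N, rfl⟩, (Nat.lt_pow_self (by omega)).le⟩) ?_
  rintro _ ⟨N, rfl⟩ v hv
  have hiter : ∀ (M : ℕ) (t w), T^[M] (w + t) = k ^ M • w + T^[M] t := by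
    intro M
    induction M with
    | zero => intro t w; simp
    | succ M ih =>
      intro t w
      rw [Function.iterate_succ_apply', ih, Function.iterate_succ_apply', hT]
      simp only [smul_add, pow_succ', mul_smul, add_assoc]
  have hN : T^[N] ⁻¹' F =ᵐ[volume] F :=
    hmp.quasiMeasurePreserving.preimage_iterate_ae_eq N heq
  have hinv : (v + ·) ⁻¹' (T^[N] ⁻¹' F) = T^[N] ⁻¹' F := by
    ext t
    simp only [mem_preimage, hiter, hv, zero_add]
  have hqmp := (measurePreserving_add_left (volume : Measure (UnitAddTorus (Fin n))) v).quasiMeasurePreserving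
  have h1 : (v + ·) ⁻¹' (T^[N] ⁻¹' F) =ᵐ[volume] (v + ·) ⁻¹' F := hqmp.preimage_ae_eq hN
  rw [hinv] at h1
  exact h1.symm.trans hN

end Torus

/-! ### Gaps between integers coprime to `d`. -/

/-- If every prime-power part of `d` were at most `B`, each would divide `B!`, hence so would `d`.
-/
theorem exists_ordProj_gt_of_factorial_lt {d B : ℕ} (h : B.factorial < d) :
    ∃ l : ℕ, l.Prime ∧ B < ordProj[l] d := by
  by_contra! hcon
  have hd : d ≠ 0 := by omega
  refine absurd (Nat.le_of_dvd B.factorial_pos ?_) (not_le.2 h)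
  rw [Nat.dvd_iff_prime_pow_dvd_dvd]
  intro p k hp hk
  have h1 : p ^ k ∣ ordProj[p] d :=
    pow_dvd_pow p ((hp.pow_dvd_iff_le_factorization hd).1 hk)
  exact h1.trans (Nat.dvd_factorial (Nat.ordProj_pos d p) (hcon p hp))

theorem exists_int_abs_add_le_modEq_one {u : ℕ} (hu : u ≠ 0) (y : ℝ) :
    ∃ s : ℤ, |y + (1 + u * s : ℤ)| ≤ u := by
  have hu' : (0 : ℝ) < u := by exact_mod_cast Nat.pos_of_ne_zero hu
  refine ⟨⌊(-y - 1) / u⌋, ?_⟩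
  have h1 := Int.floor_le ((-y - 1) / u)
  have h2 := Int.lt_floor_add_one ((-y - 1) / u)
  rw [le_div_iff₀ hu'] at h1
  rw [div_lt_iff₀ hu'] at h2
  push_cast
  rw [abs_le]
  constructor <;> nlinarith

theorem Nat.Prime.not_dvd_one_add_mul {r u : ℕ} (hr : r.Prime) (h : r ∣ u) (s : ℤ) :
    ¬ (r : ℤ) ∣ 1 + u * s := by
  intro hd
  have : (r : ℤ) ∣ 1 := (Int.dvd_add_left ((Int.natCast_dvd_natCast.2 h).mul_right s)).1 hd
  exact hr.one_lt.ne' (by exact_mod_cast Int.eq_one_of_dvd_one (by positivity) this)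

/-- Small `d` is handled by the progression `1 + d * s`. A large `d` has a prime-power part
exceeding `B`, with cofactor `u < d / B`. Of two consecutive terms `1 + u * s`, both coprime to `u`,
at least one avoids the prime `l`, since `l ∤ u`. -/
theorem exists_int_coprime_near {c : ℝ} (hc : 0 < c) :
    ∃ N : ℝ, ∀ L ≥ N, ∀ d : ℕ, d ≠ 0 → (d : ℝ) ≤ L → ∀ y : ℝ,
      ∃ a : ℤ, (∀ r : ℕ, r.Prime → r ∣ d → ¬ (r : ℤ) ∣ a) ∧ |y + a| < c * L := by
  obtain ⟨B, hB⟩ := exists_nat_gt (2 / c)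
  refine ⟨B.factorial / c + 1, fun L hL d hd hdL y => ?_⟩
  have hL0 : 0 < L := lt_of_lt_of_le (by positivity) hL
  by_cases hdB : d ≤ B.factorial
  · obtain ⟨s, hs⟩ := exists_int_abs_add_le_modEq_one hd y
    refine ⟨_, fun r hr hrd => hr.not_dvd_one_add_mul hrd s, hs.trans_lt ?_⟩
    have h1 : (d : ℝ) ≤ B.factorial := by exact_mod_cast hdB
    have h2 : (B.factorial : ℝ) / c < L := by linarith
    rw [div_lt_iff₀ hc] at h2
    linarith
  · obtain ⟨l, hl, hlB⟩ := exists_ordProj_gt_of_factorial_lt (not_le.1 hdB)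
    set u := ordCompl[l] d with hu
    have hu0 : u ≠ 0 := (Nat.ordCompl_pos l hd).ne'
    have hmul : ordProj[l] d * u = d := Nat.ordProj_mul_ordCompl_eq_self d l
    have hlu : ¬ l ∣ u := Nat.not_dvd_ordCompl hl hd
    obtain ⟨s, hs⟩ := exists_int_abs_add_le_modEq_one hu0 y
    -- One `u` pays for reaching the progression, the other for a possible shift by one term; `B > 2
    -- / c` was chosen for this.
    have hsmall : (2 : ℝ) * u < c * L := by
      have h1 : (B : ℝ) * u ≤ L := by
        refine le_trans ?_ hdL
        rw [← hmul]
        push_cast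
        gcongr
        exact_mod_cast hlB.le
      rw [div_lt_iff₀ hc] at hB
      have : (0 : ℝ) < u := by positivity
      nlinarith
    have hu1 : (0 : ℝ) ≤ u := by positivity
    have key : ∀ s' : ℤ, ¬ (l : ℤ) ∣ 1 + u * s' →
        ∀ r : ℕ, r.Prime → r ∣ d → ¬ (r : ℤ) ∣ 1 + u * s' := by
      intro s' hs' r hr hrd
      rw [← hmul, hr.dvd_mul] at hrd
      rcases hrd with h | h
      · rwa [(Nat.prime_dvd_prime_iff_eq hr hl).1 (hr.dvd_of_dvd_pow h)]
      · exact hr.not_dvd_one_add_mul h s'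
    by_cases hls : (l : ℤ) ∣ 1 + u * s
    · refine ⟨_, key (s + 1) fun h => hlu ?_, ?_⟩
      · have : (l : ℤ) ∣ (1 + u * (s + 1)) - (1 + u * s) := dvd_sub h hls
        ring_nf at this
        exact_mod_cast this
      · have : |y + (1 + u * (s + 1) : ℤ)| ≤ |y + (1 + u * s : ℤ)| + u := by
          have e : y + ((1 + u * (s + 1) : ℤ) : ℝ) = (y + (1 + u * s : ℤ)) + u := by
            push_cast; ring
          rw [e]
          exact (abs_add_le _ _).trans (by rw [abs_of_nonneg hu1])
        linarith
    · exact ⟨_, key s hls, by linarith⟩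

/-! ### Strips around integer hyperplanes. -/

section Strips

variable {n : ℕ}

/-- The entries of `q` together with `a` and `g` have no common prime factor. -/
def CoprimeTriple (q : Fin n → ℤ) (a g : ℤ) : Prop :=
  ∀ r : ℕ, r.Prime → (∀ c, (r : ℤ) ∣ q c) → (r : ℤ) ∣ a → ¬ (r : ℤ) ∣ g

/-- The union of the strips `|q · x + a| < δ` over all `a` coprime to `q` and `g`. -/
def coprimeStrip (q : Fin n → ℤ) (g : ℤ) (δ : ℝ) : Set (Fin n → ℝ) :=
  {x | ∃ a : ℤ, CoprimeTriple q a g ∧ |(∑ c, (q c : ℝ) * x c) + a| < δ}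

/-- The union of the hyperplanes `q · x + a = 0` over all `a` coprime to `q` and `g`. -/
def coprimePlanes (q : Fin n → ℤ) (g : ℤ) : Set (Fin n → ℝ) :=
  {x | ∃ a : ℤ, CoprimeTriple q a g ∧ (∑ c, (q c : ℝ) * x c) + a = 0}

theorem sum_abs_intCast_pos {q : Fin n → ℤ} (hq : q ≠ 0) : 0 < ∑ c, |(q c : ℝ)| := by
  obtain ⟨c, hc⟩ := Function.ne_iff.1 hq
  refine Finset.sum_pos' (fun _ _ => abs_nonneg _) ⟨c, Finset.mem_univ c, ?_⟩
  simpa using hc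

theorem thickening_coprimePlanes {q : Fin n → ℤ} (hq : q ≠ 0) (g : ℤ) (δ : ℝ) :
    Metric.thickening δ (coprimePlanes q g) = coprimeStrip q g (δ * ∑ c, |(q c : ℝ)|) := by
  have hS := sum_abs_intCast_pos hq
  set S := ∑ c, |(q c : ℝ)| with hSdef
  ext x
  rw [Metric.mem_thickening_iff]
  constructor
  · rintro ⟨y, ⟨a, ha, hya⟩, hxy⟩
    refine ⟨a, ha, ?_⟩
    have e : (∑ c, (q c : ℝ) * x c) + a = ∑ c, (q c : ℝ) * (x c - y c) := by
      simp only [mul_sub, Finset.sum_sub_distrib]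
      linarith
    rw [e]
    calc |∑ c, (q c : ℝ) * (x c - y c)| ≤ ∑ c, |(q c : ℝ) * (x c - y c)| :=
          Finset.abs_sum_le_sum_abs _ _
      _ ≤ ∑ c, |(q c : ℝ)| * dist x y := by
          refine Finset.sum_le_sum fun c _ => ?_
          rw [abs_mul]
          gcongr
          exact dist_le_pi_dist x y c
      _ = dist x y * S := by rw [← Finset.sum_mul, mul_comm]
      _ < δ * S := by gcongr
  · rintro ⟨a, ha, hxa⟩
    set v := (∑ c, (q c : ℝ) * x c) + a with hv
    -- A nearest point of the hyperplane in the sup norm: every coordinate with `q c ≠ 0` moves by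
    -- `|v| / S`, the `ℓ¹` norm being dual to the sup norm.
    refine ⟨fun c => x c - v / S * SignType.sign (q c : ℝ), ⟨a, ha, ?_⟩, ?_⟩
    · have e : ∑ c, (q c : ℝ) * (x c - v / S * SignType.sign (q c : ℝ)) =
          (∑ c, (q c : ℝ) * x c) - v / S * S := by
        rw [hSdef, Finset.mul_sum, ← Finset.sum_sub_distrib]
        refine Finset.sum_congr rfl fun c _ => ?_
        rw [← self_mul_sign (q c : ℝ)]
        ring
      rw [e, div_mul_cancel₀ _ hS.ne']
      linarith
    · have hδ : 0 < δ := by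
        have := (abs_nonneg v).trans_lt hxa
        exact (pos_iff_pos_of_mul_pos this).2 hS
      rw [dist_pi_lt_iff hδ]
      intro c
      rw [Real.dist_eq, sub_sub_cancel, abs_mul, abs_div, abs_of_pos hS]
      have h1 : |((SignType.sign (q c : ℝ) : SignType) : ℝ)| ≤ 1 := by
        cases SignType.sign (q c : ℝ) <;> simp
      have h2 : |v| / S < δ := by rwa [div_lt_iff₀ hS]
      have h3 : 0 ≤ |v| / S := by positivity
      nlinarith

theorem isOpen_coprimeStrip (q : Fin n → ℤ) (g : ℤ) (δ : ℝ) : IsOpen (coprimeStrip q g δ) := by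
  have : coprimeStrip q g δ = ⋃ (a : ℤ) (_ : CoprimeTriple q a g),
      {x | |(∑ c, (q c : ℝ) * x c) + a| < δ} := by
    ext x; simp [coprimeStrip]
  rw [this]
  exact isOpen_iUnion fun a => isOpen_iUnion fun _ => isOpen_lt (by fun_prop) continuous_const

theorem coprimeStrip_mono (q : Fin n → ℤ) (g : ℤ) {δ δ' : ℝ} (h : δ ≤ δ') :
    coprimeStrip q g δ ⊆ coprimeStrip q g δ' :=
  fun _ ⟨a, ha, hx⟩ => ⟨a, ha, hx.trans_le h⟩

theorem CoprimeTriple.add_of_forall_dvd {q : Fin n → ℤ} {a g b : ℤ} (h : CoprimeTriple q a g)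
    (hb : ∀ r : ℕ, r.Prime → (∀ c, (r : ℤ) ∣ q c) → (r : ℤ) ∣ g → (r : ℤ) ∣ b) :
    CoprimeTriple q (a + b) g := fun r hr hq ha hg =>
  h r hr hq ((Int.dvd_add_left (hb r hr hq hg)).1 ha) hg

theorem add_intCast_mem_coprimeStrip {q : Fin n → ℤ} {g : ℤ} {δ : ℝ} {x : Fin n → ℝ}
    (hx : x ∈ coprimeStrip q g δ) (z : Fin n → ℤ) :
    (fun c => x c + z c) ∈ coprimeStrip q g δ := by
  obtain ⟨a, ha, hxa⟩ := hx
  refine ⟨a + -∑ c, q c * z c, ha.add_of_forall_dvd fun r _ hr _ =>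
    (Finset.dvd_sum fun c _ => (hr c).mul_right _).neg_right, ?_⟩
  convert! hxa using 2
  push_cast
  simp only [mul_add, Finset.sum_add_distrib]
  ring

/-- Coprimality of `a` to the gcd of `q` suffices whatever `g` is, and that gcd is at most `‖q‖₁`,
so the gap bound applies with `L = ‖q‖₁`. -/
theorem exists_forall_mem_coprimeStrip {ε : ℝ} (hε : 0 < ε) :
    ∃ N : ℝ, ∀ q : Fin n → ℤ, q ≠ 0 → N ≤ ∑ c, |(q c : ℝ)| → ∀ (g : ℤ) (x : Fin n → ℝ),
      x ∈ coprimeStrip q g (ε * ∑ c, |(q c : ℝ)|) := by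
  obtain ⟨N, hN⟩ := exists_int_coprime_near hε
  refine ⟨N, fun q hq hqN g x => ?_⟩
  have hgcd : ∀ c, Finset.univ.gcd q ∣ q c := fun c => Finset.gcd_dvd (Finset.mem_univ c)
  obtain ⟨c, hc⟩ := Function.ne_iff.1 hq
  have hd : (Finset.univ.gcd q).natAbs ≠ 0 := by
    rw [Int.natAbs_ne_zero]
    intro h0
    exact hc (zero_dvd_iff.1 (h0 ▸ hgcd c))
  have hle : ((Finset.univ.gcd q).natAbs : ℝ) ≤ ∑ c, |(q c : ℝ)| := by
    have h1 : (Finset.univ.gcd q).natAbs ≤ (q c).natAbs :=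
      Nat.le_of_dvd (Int.natAbs_pos.2 hc) (Int.natAbs_dvd_natAbs.2 (hgcd c))
    calc ((Finset.univ.gcd q).natAbs : ℝ) ≤ (q c).natAbs := by exact_mod_cast h1
      _ = |(q c : ℝ)| := by rw [Nat.cast_natAbs, Int.cast_abs]
      _ ≤ _ := Finset.single_le_sum (f := fun c => |(q c : ℝ)|) (fun _ _ => abs_nonneg _)
          (Finset.mem_univ c)
  obtain ⟨a, ha, hxa⟩ := hN _ hqN _ hd hle (∑ c, (q c : ℝ) * x c)
  refine ⟨a, fun r hr hq' hra _ => ha r hr ?_ hra, hxa⟩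
  rw [← Int.natCast_dvd]
  exact Finset.dvd_gcd fun c _ => hq' c

end Strips

/-! ### Limsup sets of strips: scaling and the zero-one law. -/

theorem measurableSet_setOf_infinite {ι Ω : Type*} [Countable ι] [MeasurableSpace Ω]
    {U : ι → Set Ω} (hU : ∀ i, MeasurableSet (U i)) :
    MeasurableSet {x | {i | x ∈ U i}.Infinite} := by
  have : {x | {i | x ∈ U i}.Infinite} = ⋂ s : Finset ι, ⋃ i, ⋃ (_ : i ∉ s), U i := by
    ext x
    simp only [mem_ofPred_eq, mem_iInter, mem_iUnion, exists_prop]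
    refine ⟨fun h s => ?_, fun h hfin => ?_⟩
    · obtain ⟨i, hi, his⟩ := h.exists_notMem_finset s
      exact ⟨i, his, hi⟩
    · obtain ⟨i, hi, hix⟩ := h hfin.toFinset
      exact hi (hfin.mem_toFinset.2 hix)
  rw [this]
  exact MeasurableSet.iInter fun s => MeasurableSet.iUnion fun i => MeasurableSet.iUnion fun _ => hU i

section LimsupStrip

variable {n : ℕ} {ι : Type*}

/-- The set of points lying in infinitely many of the strips with index satisfying `P`. -/
def limsupStrip (P : ι → Prop) (Q : ι → Fin n → ℤ) (g : ι → ℤ) (r : ι → ℝ) :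
    Set (Fin n → ℝ) :=
  {x | {i | P i ∧ x ∈ coprimeStrip (Q i) (g i) (r i)}.Infinite}

variable {P : ι → Prop} {Q : ι → Fin n → ℤ} {g : ι → ℤ} {r : ι → ℝ}

theorem measurableSet_limsupStrip [Countable ι] : MeasurableSet (limsupStrip P Q g r) :=
  measurableSet_setOf_infinite (U := fun i => {x | P i ∧ x ∈ coprimeStrip (Q i) (g i) (r i)})
    fun i => (MeasurableSet.const (P i)).inter (isOpen_coprimeStrip _ _ _).measurableSet

theorem mem_limsupStrip_of_forall {P' : ι → Prop} {r' : ι → ℝ} {x y : Fin n → ℝ}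
    (h : ∀ i, P i → x ∈ coprimeStrip (Q i) (g i) (r i) →
      P' i ∧ y ∈ coprimeStrip (Q i) (g i) (r' i))
    (hx : x ∈ limsupStrip P Q g r) : y ∈ limsupStrip P' Q g r' :=
  Set.Infinite.mono (fun i hi => h i hi.1 hi.2) hx

theorem limsupStrip_eq_blimsup (hQ : ∀ i, Q i ≠ 0) (e : ℕ ≃ ι) :
    limsupStrip P Q g r =
      (blimsup (fun j => Metric.thickening (r (e j) / ∑ c, |(Q (e j) c : ℝ)|)
        (coprimePlanes (Q (e j)) (g (e j)))) atTop (fun j => P (e j)) : Set (Fin n → ℝ)) := by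
  rw [← Nat.cofinite_eq_atTop, cofinite.blimsup_set_eq]
  ext x
  simp only [limsupStrip, mem_ofPred_eq, thickening_coprimePlanes (hQ _),
    div_mul_cancel₀ _ (sum_abs_intCast_pos (hQ _)).ne']
  rw [← Set.infinite_image_iff e.injective.injOn]
  congr! 1
  ext i
  simp only [mem_ofPred_eq, mem_image]
  exact ⟨fun h => ⟨e.symm i, by simpa using h, by simp⟩, by rintro ⟨j, hj, rfl⟩; exact hj⟩

/-- Cassels' lemma: multiplying thickening radii that tend to zero by a positive constant changes
the limsup set only by a null set. -/
theorem limsupStrip_mul_ae_eq [Countable ι] (hQ : ∀ i, Q i ≠ 0)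
    (hr : Tendsto (fun i => r i / ∑ c, |(Q i c : ℝ)|) cofinite (𝓝 0)) {k : ℝ} (hk : 0 < k) :
    limsupStrip P Q g (fun i => k * r i) =ᵐ[volume] limsupStrip P Q g r := by
  cases finite_or_infinite ι with
  | inl _ =>
    have h : ∀ r', limsupStrip P Q g r' = ∅ := fun r' =>
      eq_empty_of_forall_notMem fun x hx => hx (Set.toFinite _)
    rw [h, h]
    exact EventuallyEq.rfl
  | inr _ =>
    obtain ⟨e⟩ : Nonempty (ℕ ≃ ι) := nonempty_equiv_of_countable
    rw [limsupStrip_eq_blimsup hQ e, limsupStrip_eq_blimsup hQ e]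
    simp only [mul_div_assoc]
    refine blimsup_thickening_mul_ae_eq volume (fun j => P (e j))
      (fun j => coprimePlanes (Q (e j)) (g (e j))) hk
      (fun j => r (e j) / ∑ c, |(Q (e j) c : ℝ)|) ?_
    rw [← Nat.cofinite_eq_atTop]
    exact hr.comp e.injective.tendsto_cofinite

theorem exists_torusSection_coe_eq (x : Fin n → ℝ) :
    ∃ z : Fin n → ℤ, torusSection n (fun c => (x c : UnitAddCircle)) = fun c => x c + z c := by
  have h : ∀ c, ∃ z : ℤ, torusSection n (fun c => (x c : UnitAddCircle)) c = x c + z := by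
    intro c
    have := coe_torusSection (fun c => (x c : UnitAddCircle)) c
    rw [eq_comm, QuotientAddGroup.eq, AddSubgroup.mem_zmultiples_iff] at this
    obtain ⟨z, hz⟩ := this
    exact ⟨z, by simp at hz; linarith⟩
  choose z hz using h
  exact ⟨z, funext hz⟩

theorem torusSection_coe_mem_limsupStrip {x : Fin n → ℝ} (hx : x ∈ limsupStrip P Q g r) :
    torusSection n (fun c => (x c : UnitAddCircle)) ∈ limsupStrip P Q g r := by
  obtain ⟨z, hz⟩ := exists_torusSection_coe_eq x
  rw [hz]
  exact mem_limsupStrip_of_forall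
    (fun i hi hx => ⟨hi, add_intCast_mem_coprimeStrip hx z⟩) hx

theorem quasiMeasurePreserving_torusSection :
    Measure.QuasiMeasurePreserving (torusSection n) volume volume := by
  refine measurePreserving_torusSection.quasiMeasurePreserving.mono_right ?_
  rw [← Measure.restrict_pi_pi]
  exact Measure.absolutelyContinuous_of_le Measure.restrict_le_self

theorem nsmul_add_mem_coprimeStrip {q : Fin n → ℤ} {g : ℤ} {δ : ℝ} {x u : Fin n → ℝ} {k : ℕ}
    (hk : k ≠ 0) {b : ℤ} (hu : ∑ c, (q c : ℝ) * u c = b)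
    (h : ∀ a, CoprimeTriple q a g → CoprimeTriple q (k * a - b) g)
    (hx : x ∈ coprimeStrip q g δ) :
    (fun c => k * x c + u c) ∈ coprimeStrip q g (k * δ) := by
  obtain ⟨a, ha, hxa⟩ := hx
  have hk' : (0 : ℝ) < k := by positivity
  refine ⟨k * a - b, h a ha, ?_⟩
  have e : (∑ c, (q c : ℝ) * (k * x c + u c)) + ((k * a - b : ℤ) : ℝ) =
      k * ((∑ c, (q c : ℝ) * x c) + a) := by
    simp only [mul_add, Finset.sum_add_distrib, hu, Finset.mul_sum]
    push_cast
    simp only [mul_left_comm]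
    ring
  rw [e, abs_mul, abs_of_pos hk']
  gcongr

/-- The map `x ↦ k x + u` sends a strip into one `k` times wider, with `a` replaced by `k a - b`.
The extra width is harmless by scaling, so the set lies a.e. in its own preimage. -/
theorem eventuallyConst_preimage_limsupStrip_of_dilation [Countable ι] (hQ : ∀ i, Q i ≠ 0)
    (hr : Tendsto (fun i => r i / ∑ c, |(Q i c : ℝ)|) cofinite (𝓝 0)) {k : ℕ} (hk : 2 ≤ k)
    (u : Fin n → ℝ) (h : ∀ i, P i → ∃ b : ℤ, ∑ c, (Q i c : ℝ) * u c = b ∧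
      ∀ a, CoprimeTriple (Q i) a (g i) → CoprimeTriple (Q i) (k * a - b) (g i)) :
    EventuallyConst (torusSection n ⁻¹' limsupStrip P Q g r) (ae volume) := by
  have hk0 : (0 : ℝ) < k := by exact_mod_cast (by omega : 0 < k)
  set T : UnitAddTorus (Fin n) → UnitAddTorus (Fin n) :=
    fun t => k • t + fun c => (u c : UnitAddCircle) with hT
  have hmp : MeasurePreserving T volume volume := measurePreserving_nsmul_add k (by omega) _
  refine eventuallyConst_of_ae_subset_preimage_nsmul_add
    (measurePreserving_torusSection.measurable measurableSet_limsupStrip) hk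
    (fun c => (u c : UnitAddCircle)) ?_
  have h1 : torusSection n ⁻¹' limsupStrip P Q g r ⊆
      T ⁻¹' (torusSection n ⁻¹' limsupStrip P Q g (fun i => k * r i)) := by
    intro t ht
    have hmem : (fun c => k * torusSection n t c + u c) ∈
        limsupStrip P Q g (fun i => k * r i) :=
      mem_limsupStrip_of_forall (fun i hi hx => by
        obtain ⟨b, hb, hcop⟩ := h i hi
        exact ⟨hi, nsmul_add_mem_coprimeStrip (by omega) hb hcop hx⟩) ht
    have := torusSection_coe_mem_limsupStrip hmem
    have hTt : T t = fun c => ((k * torusSection n t c + u c : ℝ) : UnitAddCircle) := by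
      funext c
      change k • t c + (u c : UnitAddCircle) = _
      rw [AddCircle.coe_add, ← nsmul_eq_mul, AddCircle.coe_nsmul, coe_torusSection]
    rwa [mem_preimage, mem_preimage, hTt]
  have h2 := hmp.quasiMeasurePreserving.preimage_ae_eq
    (quasiMeasurePreserving_torusSection.preimage_ae_eq
      (limsupStrip_mul_ae_eq (P := P) (g := g) hQ hr hk0))
  exact (LE.le.eventuallyLE h1).trans h2.le

/-- Under `x ↦ l x` the integer `a` becomes `l a`; the only new prime factor possible is `l`, which
does not divide both `q` and `g`. -/
theorem eventuallyConst_preimage_limsupStrip_not_dvd [Countable ι] (hQ : ∀ i, Q i ≠ 0)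
    (hr : Tendsto (fun i => r i / ∑ c, |(Q i c : ℝ)|) cofinite (𝓝 0)) {l : ℕ} (hl : l.Prime) :
    EventuallyConst (torusSection n ⁻¹' limsupStrip
      (fun i => ¬ ((∀ c, (l : ℤ) ∣ Q i c) ∧ (l : ℤ) ∣ g i)) Q g r) (ae volume) := by
  refine eventuallyConst_preimage_limsupStrip_of_dilation hQ hr hl.two_le 0 fun i hi =>
    ⟨0, by simp, fun a ha p hp hpq hpa hpg => ?_⟩
  rw [sub_zero] at hpa
  rcases (Nat.prime_iff_prime_int.1 hp).dvd_or_dvd hpa with h | h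
  · have : p = l := (Nat.prime_dvd_prime_iff_eq hp hl).1 (by exact_mod_cast h)
    subst this
    exact hi ⟨hpq, hpg⟩
  · exact ha p hp hpq h hpg

/-- Here `l a` might share the factor `l` with `q` and `g`. Adding `1 / l` in coordinate `c`
replaces it by `l a - b` with `b = q c / l` prime to `l`. -/
theorem eventuallyConst_preimage_limsupStrip_dvd_not_sq_dvd [Countable ι] (hQ : ∀ i, Q i ≠ 0)
    (hr : Tendsto (fun i => r i / ∑ c, |(Q i c : ℝ)|) cofinite (𝓝 0)) {l : ℕ} (hl : l.Prime)
    (c : Fin n) :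
    EventuallyConst (torusSection n ⁻¹' limsupStrip
      (fun i => (∀ c, (l : ℤ) ∣ Q i c) ∧ ¬ (l : ℤ) ^ 2 ∣ Q i c) Q g r) (ae volume) := by
  refine eventuallyConst_preimage_limsupStrip_of_dilation hQ hr hl.two_le
    (Pi.single c (1 / l : ℝ)) fun i hi => ?_
  obtain ⟨b, hb⟩ := hi.1 c
  have hl0 : (l : ℝ) ≠ 0 := by exact_mod_cast hl.ne_zero
  have hlb : ¬ (l : ℤ) ∣ b := fun h => hi.2 (by rw [hb, sq]; exact mul_dvd_mul_left _ h)
  refine ⟨b, ?_, fun a ha p hp hpq hpa hpg => ?_⟩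
  · rw [Finset.sum_eq_single c (fun c' _ hc' => by simp [hc']) (by simp), hb]
    simp
    field_simp
  · have hpb : (p : ℤ) ∣ l * b := hb ▸ hpq c
    rcases (Nat.prime_iff_prime_int.1 hp).dvd_or_dvd hpb with h | h
    · have : p = l := (Nat.prime_dvd_prime_iff_eq hp hl).1 (by exact_mod_cast h)
      subst this
      exact hlb ((dvd_sub_right (dvd_mul_right _ _)).1 hpa)
    · have h2 : (p : ℤ) ∣ l * a := (dvd_sub_left h).1 hpa
      rcases (Nat.prime_iff_prime_int.1 hp).dvd_or_dvd h2 with h3 | h3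
      · have : p = l := (Nat.prime_dvd_prime_iff_eq hp hl).1 (by exact_mod_cast h3)
        subst this
        exact hlb h
      · exact ha p hp hpq h3 hpg

/-- Translation by `l`-torsion changes `a` by a multiple of `l` times an integer combination of the
`q c / l²`; every prime dividing all `q c` divides this change, so coprimality survives. -/
theorem preimage_torsion_add_limsupStrip_sq_dvd {l : ℕ} (hl : l.Prime)
    {u : UnitAddTorus (Fin n)} (hu : l • u = 0) :
    (u + ·) ⁻¹' (torusSection n ⁻¹' limsupStrip (fun i => ∀ c, (l : ℤ) ^ 2 ∣ Q i c) Q g r) =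
      torusSection n ⁻¹' limsupStrip (fun i => ∀ c, (l : ℤ) ^ 2 ∣ Q i c) Q g r := by
  set F := torusSection n ⁻¹' limsupStrip (fun i => ∀ c, (l : ℤ) ^ 2 ∣ Q i c) Q g r with hF
  have hl0 : (l : ℝ) ≠ 0 := by exact_mod_cast hl.ne_zero
  have key : ∀ v : UnitAddTorus (Fin n), l • v = 0 → ∀ t ∈ F, v + t ∈ F := by
    intro v hv t ht
    have hz : ∀ c, ∃ z : ℤ, (z : ℝ) = l * torusSection n v c := by
      intro c
      have h1 : ((l • torusSection n v c : ℝ) : UnitAddCircle) = 0 := by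
        rw [AddCircle.coe_nsmul, coe_torusSection]
        exact congrFun hv c
      rw [AddCircle.coe_eq_zero_iff] at h1
      obtain ⟨z, hz⟩ := h1
      exact ⟨z, by simpa using hz⟩
    choose z hz using hz
    have hmem : (fun c => (1 : ℕ) * torusSection n t c + torusSection n v c) ∈
        limsupStrip (fun i => ∀ c, (l : ℤ) ^ 2 ∣ Q i c) Q g r := by
      refine mem_limsupStrip_of_forall (fun i hi hx => ⟨hi, ?_⟩) ht
      choose w hw using hi
      rw [← one_mul (r i), ← Nat.cast_one]
      refine nsmul_add_mem_coprimeStrip one_ne_zero (b := ∑ c, l * w c * z c) ?_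
        (fun a ha => ?_) hx
      · push_cast
        refine Finset.sum_congr rfl fun c _ => ?_
        rw [hw c, hz c]
        push_cast
        ring
      · rw [Nat.cast_one, one_mul, sub_eq_add_neg]
        refine ha.add_of_forall_dvd fun p hp hpq _ => ?_
        rw [dvd_neg]
        refine Finset.dvd_sum fun c _ => Dvd.dvd.mul_right ?_ _
        have h3 := hpq c
        rw [hw c, sq, mul_assoc] at h3
        rcases (Nat.prime_iff_prime_int.1 hp).dvd_or_dvd h3 with h | h
        · exact h.mul_right _
        · exact h
    have := torusSection_coe_mem_limsupStrip hmem
    have hvt : v + t = fun c =>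
        (((1 : ℕ) * torusSection n t c + torusSection n v c : ℝ) : UnitAddCircle) := by
      funext c
      rw [Nat.cast_one, one_mul, AddCircle.coe_add, coe_torusSection, coe_torusSection, add_comm,
        Pi.add_apply]
    rwa [hF, mem_preimage, hvt]
  ext t
  refine ⟨fun ht => ?_, key u hu t⟩
  have := key (-u) (by rw [smul_neg, hu, neg_zero]) _ ht
  simpa using this

/-- A non-null piece of one of the first two kinds, for some prime, is full and forces the whole set
to be full. Otherwise, for every prime `l`, the set agrees a.e. with its `l²`-divisible piece and so
inherits `l`-torsion invariance; torsion of prime order is dense. -/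
theorem eventuallyConst_preimage_limsupStrip [Countable ι] (hQ : ∀ i, Q i ≠ 0)
    (hr : Tendsto (fun i => r i / ∑ c, |(Q i c : ℝ)|) cofinite (𝓝 0)) :
    EventuallyConst (torusSection n ⁻¹' limsupStrip (fun _ => True) Q g r) (ae volume) := by
  set F := fun P : ι → Prop => torusSection n ⁻¹' limsupStrip P Q g r with hF
  have hmono : ∀ P, F P ⊆ F fun _ => True := fun P t ht =>
    mem_limsupStrip_of_forall (fun i _ hx => ⟨trivial, hx⟩) ht
  have hfull : ∀ P, EventuallyConst (F P) (ae volume) → ¬ F P =ᵐ[volume] (∅ : Set _) →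
      EventuallyConst (F fun _ => True) (ae volume) := by
    intro P hP hne
    have h1 := (eventuallyConst_set'.1 hP).resolve_left hne
    refine eventuallyConst_set'.2 (Or.inr ?_)
    filter_upwards [eventuallyEq_univ.1 h1] with t ht
    exact propext ⟨fun _ => trivial, fun _ => hmono P ht⟩
  by_cases h1 : ∃ l : ℕ, l.Prime ∧
      ¬ F (fun i => ¬ ((∀ c, (l : ℤ) ∣ Q i c) ∧ (l : ℤ) ∣ g i)) =ᵐ[volume] (∅ : Set _)
  · obtain ⟨l, hl, h⟩ := h1
    exact hfull _ (eventuallyConst_preimage_limsupStrip_not_dvd hQ hr hl) h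
  by_cases h2 : ∃ l : ℕ, l.Prime ∧ ∃ c,
      ¬ F (fun i => (∀ c, (l : ℤ) ∣ Q i c) ∧ ¬ (l : ℤ) ^ 2 ∣ Q i c) =ᵐ[volume] (∅ : Set _)
  · obtain ⟨l, hl, c, h⟩ := h2
    exact hfull _ (eventuallyConst_preimage_limsupStrip_dvd_not_sq_dvd hQ hr hl c) h
  push Not at h1 h2
  refine eventuallyConst_of_forall_torsion_vadd
    (measurePreserving_torusSection.measurable measurableSet_limsupStrip).nullMeasurableSet
    {l | l.Prime} (fun N => ?_) fun l hl u hu => ?_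
  · obtain ⟨l, hNl, hl⟩ := Nat.exists_infinite_primes N
    exact ⟨l, hl, hNl⟩
  have heq : F (fun _ => True) =ᵐ[volume] F (fun i => ∀ c, (l : ℤ) ^ 2 ∣ Q i c) := by
    have h2' := ae_all_iff.2 fun c => eventuallyEq_empty.1 (h2 l hl c)
    filter_upwards [eventuallyEq_empty.1 (h1 l hl), h2'] with t ht1 ht2
    refine propext ⟨fun ht => ?_, fun ht => hmono _ ht⟩
    have hfin := (not_infinite.1 ht1).union
      (Set.finite_iUnion fun c => not_infinite.1 (ht2 c))
    refine (Set.Infinite.sdiff ht hfin).mono ?_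
    rintro i ⟨⟨-, hi⟩, hi'⟩
    simp only [mem_union, mem_iUnion, mem_ofPred_eq, not_or, not_exists, not_and] at hi'
    refine ⟨fun c => ?_, hi⟩
    by_contra hc
    by_cases hd : (∀ c, (l : ℤ) ∣ Q i c) ∧ (l : ℤ) ∣ g i
    · exact hi'.2 c ⟨hd.1, hc⟩ hi
    · exact hi'.1 (not_and.1 hd) hi
  have hqmp := (measurePreserving_add_left
    (volume : Measure (UnitAddTorus (Fin n))) u).quasiMeasurePreserving
  have h3 := hqmp.preimage_ae_eq heq
  have h4 : (u + ·) ⁻¹' F (fun i => ∀ c, (l : ℤ) ^ 2 ∣ Q i c) =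
      F (fun i => ∀ c, (l : ℤ) ^ 2 ∣ Q i c) := preimage_torsion_add_limsupStrip_sq_dvd hl hu
  rw [h4] at h3
  exact h3.trans heq.symm

end LimsupStrip

/-! ### Zero-one laws on products from sections. -/

section ZeroOne

/-- The condition over `b` makes `S` a.e. equal to a cylinder over `B`. Almost every section over
`a` then has measure `ν B`, which the condition over `a` forces to be 0 or 1. -/
theorem measure_prod_eq_zero_or_one_of_sections {α β : Type*} [MeasurableSpace α]
    [MeasurableSpace β] {μ : Measure α} {ν : Measure β} [IsProbabilityMeasure μ]
    [IsProbabilityMeasure ν] {S : Set (α × β)} (hS : MeasurableSet S)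
    (h1 : ∀ᵐ a ∂μ, ν {b | (a, b) ∈ S} = 0 ∨ ν {b | (a, b) ∈ S} = 1)
    (h2 : ∀ᵐ b ∂ν, μ {a | (a, b) ∈ S} = 0 ∨ μ {a | (a, b) ∈ S} = 1) :
    μ.prod ν S = 0 ∨ μ.prod ν S = 1 := by
  have hmeas : Measurable fun b => μ {a | (a, b) ∈ S} := measurable_measure_prodMk_right hS
  set B : Set β := {b | μ {a | (a, b) ∈ S} = 1} with hB
  have hBm : MeasurableSet B := hmeas (measurableSet_singleton 1)
  have hSB : μ.prod ν S = ν B := by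
    rw [Measure.prod_apply_symm hS, ← lintegral_indicator_one hBm]
    refine lintegral_congr_ae ?_
    filter_upwards [h2] with b hb
    by_cases hbB : b ∈ B
    · rw [indicator_of_mem hbB]; exact hbB
    · rw [indicator_of_notMem hbB]; exact hb.resolve_right hbB
  have hae : ∀ᵐ b ∂ν, ∀ᵐ a ∂μ, ((a, b) ∈ S ↔ b ∈ B) := by
    filter_upwards [h2] with b hb
    have hbm : MeasurableSet {a | (a, b) ∈ S} := measurable_prodMk_right hS
    by_cases hbB : b ∈ B
    · filter_upwards [(mem_ae_iff_prob_eq_one hbm).2 hbB] with a ha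
      exact ⟨fun _ => hbB, fun _ => ha⟩
    · filter_upwards [measure_eq_zero_iff_ae_notMem.1 (hb.resolve_right hbB)] with a ha
      exact ⟨fun h => absurd h ha, fun h => absurd h hbB⟩
  have hae' : ∀ᵐ a ∂μ, ∀ᵐ b ∂ν, ((a, b) ∈ S ↔ b ∈ B) := by
    refine (Measure.ae_ae_comm ?_).2 hae
    exact measurableSet_setOfPred.2 ((measurableSet_setOfPred.1 hS).iff
      (measurableSet_setOfPred.1 (measurable_snd hBm)))
  obtain ⟨a, ha1, ha2⟩ := (h1.and hae').exists
  have : ν {b | (a, b) ∈ S} = ν B := measure_congr (by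
    filter_upwards [ha2] with b hb using propext hb)
  rwa [this, ← hSB] at ha1

theorem measure_pi_eq_zero_or_one_of_update {Ω : Type*} [MeasurableSpace Ω] (ν : Measure Ω)
    [IsProbabilityMeasure ν] (m : ℕ) {S : Set (Fin m → Ω)} (hS : MeasurableSet S)
    (h : ∀ j, ∀ᵐ X ∂Measure.pi (fun _ : Fin m => ν),
      ν {y | Function.update X j y ∈ S} = 0 ∨ ν {y | Function.update X j y ∈ S} = 1) :
    Measure.pi (fun _ : Fin m => ν) S = 0 ∨ Measure.pi (fun _ : Fin m => ν) S = 1 := by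
  induction m with
  | zero =>
    rcases Subsingleton.eq_empty_or_singleton (Set.subsingleton_of_subsingleton (s := S)) with h0 | ⟨x, h0⟩
    · left; simp [h0]
    · right
      have : S = univ := by rw [h0]; ext y; simp [Subsingleton.elim y x]
      rw [this, measure_univ]
  | succ m ih =>
    have hmp := (measurePreserving_piFinSuccAbove (fun _ : Fin (m + 1) => ν) 0).symm
    set e := (MeasurableEquiv.piFinSuccAbove (fun _ : Fin (m + 1) => Ω) 0).symm with he
    have he' : ∀ z, e z = Fin.cons z.1 z.2 := fun z => by
      rw [he]
      simp [Fin.consEquiv]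
    have hcons : Measurable fun z : Ω × (Fin m → Ω) => (Fin.cons z.1 z.2 : Fin (m + 1) → Ω) := by
      have := e.measurable
      rwa [show (e : _ → _) = _ from funext he'] at this
    rw [← hmp.measure_preimage hS.nullMeasurableSet]
    refine measure_prod_eq_zero_or_one_of_sections (hmp.measurable hS) ?_ ?_
    · have h' : ∀ᵐ x ∂ν, ∀ j : Fin m, ∀ᵐ X ∂Measure.pi (fun _ : Fin m => ν),
          ν {y | Fin.cons x (Function.update X j y) ∈ S} = 0 ∨
          ν {y | Fin.cons x (Function.update X j y) ∈ S} = 1 := by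
        rw [ae_all_iff]
        intro j
        filter_upwards [Measure.ae_ae_of_ae_prod (hmp.quasiMeasurePreserving.ae (h j.succ))]
          with x hx
        filter_upwards [hx] with X hX
        simpa only [he', Fin.cons_update] using hX
      filter_upwards [h'] with x hx
      have hx' : Measurable fun X : Fin m → Ω => (Fin.cons x X : Fin (m + 1) → Ω) :=
        hcons.comp measurable_prodMk_left
      have := ih (hx' hS) hx
      simp only [mem_preimage, he']
      exact this
    · have h0 := (Measure.measurePreserving_swap.quasiMeasurePreserving).ae
        (hmp.quasiMeasurePreserving.ae (h 0))
      filter_upwards [Measure.ae_ae_of_ae_prod h0] with X hX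
      -- Updating coordinate 0 forgets its old value, so a single good `x` suffices.
      obtain ⟨x, hx⟩ := hX.exists
      simpa only [mem_preimage, he', Prod.swap, Fin.update_cons_zero] using hx

end ZeroOne

/-! ### The dichotomy for a fibre. -/

section Fibre

/-- Lebesgue measure on the cube `(0, 1]ⁿ`. -/
noncomputable abbrev unitCubeMeasure (n : ℕ) : Measure (Fin n → ℝ) :=
  Measure.pi fun _ => volume.restrict (Ioc (0 : ℝ) 1)

instance isProbabilityMeasure_restrict_Ioc :
    IsProbabilityMeasure ((volume : Measure ℝ).restrict (Ioc 0 1)) :=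
  ⟨by simp⟩

variable {n : ℕ} {ι : Type*} {Q : ι → Fin n → ℤ} {g : ι → ℤ} {r : ι → ℝ}

theorem finite_setOf_sum_abs_lt (N : ℝ) : {q : Fin n → ℤ | ∑ c, |(q c : ℝ)| < N}.Finite := by
  refine (Set.finite_Icc (fun _ => -⌈N⌉) (fun _ => ⌈N⌉)).subset fun q hq => ?_
  have h : ∀ c, |q c| ≤ ⌈N⌉ := fun c => by
    have h1 : |(q c : ℝ)| ≤ ∑ c, |(q c : ℝ)| :=
      Finset.single_le_sum (f := fun c => |(q c : ℝ)|) (fun _ _ => abs_nonneg _)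
        (Finset.mem_univ c)
    have h2 : |(q c : ℝ)| ≤ ⌈N⌉ := h1.trans ((le_of_lt hq).trans (Int.le_ceil N))
    exact_mod_cast h2
  exact ⟨fun c => (abs_le.1 (h c)).1, fun c => (abs_le.1 (h c)).2⟩

theorem limsupStrip_eq_univ_of_not_tendsto (hQ : ∀ i, Q i ≠ 0) (hr0 : ∀ i, 0 ≤ r i)
    (hfin : ∀ q : Fin n → ℤ, ∀ ε > 0, {i | Q i = q ∧ ε ≤ r i}.Finite)
    (hr : ¬ Tendsto (fun i => r i / ∑ c, |(Q i c : ℝ)|) cofinite (𝓝 0)) {k : ℝ} (hk : 0 < k) :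
    limsupStrip (fun _ => True) Q g (fun i => k * r i) = univ := by
  rw [Metric.tendsto_nhds] at hr
  push Not at hr
  obtain ⟨ε, hε, hI⟩ := hr
  have hI' : {i | ε * ∑ c, |(Q i c : ℝ)| ≤ r i}.Infinite := by
    rw [frequently_cofinite_iff_infinite] at hI
    refine hI.mono fun i hi => ?_
    have hpos := sum_abs_intCast_pos (hQ i)
    simp only [mem_ofPred_eq, Real.dist_eq, sub_zero] at hi ⊢
    rwa [abs_of_nonneg (div_nonneg (hr0 i) hpos.le), le_div_iff₀ hpos] at hi
  obtain ⟨N, hN⟩ := exists_forall_mem_coprimeStrip (n := n) (mul_pos hk hε)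
  have hsmall : {i | ε * ∑ c, |(Q i c : ℝ)| ≤ r i ∧ ∑ c, |(Q i c : ℝ)| < N}.Finite := by
    -- The zero vector is excluded because its threshold `ε * 0` is not positive, so `hfin` would
    -- not apply.
    refine ((finite_setOf_sum_abs_lt (n := n) N).biUnion (t := fun q =>
      if q = 0 then ∅ else {i | Q i = q ∧ ε * ∑ c, |(q c : ℝ)| ≤ r i}) fun q _ => ?_).subset ?_
    · split_ifs with hq
      · exact Set.finite_empty
      · exact hfin q _ (mul_pos hε (sum_abs_intCast_pos hq))
    · rintro i ⟨hi1, hi2⟩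
      refine mem_biUnion (x := Q i) hi2 ?_
      rw [if_neg (hQ i)]
      exact ⟨rfl, hi1⟩
  refine eq_univ_of_forall fun x => (hI'.sdiff hsmall).mono ?_
  rintro i ⟨hi1, hi2⟩
  have hiN : N ≤ ∑ c, |(Q i c : ℝ)| := by
    by_contra hlt
    exact hi2 ⟨hi1, not_le.1 hlt⟩
  refine ⟨trivial, coprimeStrip_mono _ _ ?_ (hN (Q i) (hQ i) hiN (g i) x)⟩
  rw [mul_assoc]
  exact mul_le_mul_of_nonneg_left hi1 hk.le

theorem unitCubeMeasure_limsupStrip [Countable ι] (hQ : ∀ i, Q i ≠ 0) (hr0 : ∀ i, 0 ≤ r i)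
    (hfin : ∀ q : Fin n → ℤ, ∀ ε > 0, {i | Q i = q ∧ ε ≤ r i}.Finite) :
    (∀ k > 0, unitCubeMeasure n (limsupStrip (fun _ => True) Q g (fun i => k * r i)) = 0 ∨
      unitCubeMeasure n (limsupStrip (fun _ => True) Q g (fun i => k * r i)) = 1) ∧
    ∀ k > 0, unitCubeMeasure n (limsupStrip (fun _ => True) Q g (fun i => k * r i)) =
      unitCubeMeasure n (limsupStrip (fun _ => True) Q g r) := by
  by_cases hr : Tendsto (fun i => r i / ∑ c, |(Q i c : ℝ)|) cofinite (𝓝 0)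
  · have hmeas : ∀ r', unitCubeMeasure n (limsupStrip (fun _ => True) Q g r') =
        volume (torusSection n ⁻¹' limsupStrip (fun _ => True) Q g r') := fun r' =>
      (measurePreserving_torusSection.measure_preimage
        measurableSet_limsupStrip.nullMeasurableSet).symm
    have heq : ∀ k > 0, unitCubeMeasure n (limsupStrip (fun _ => True) Q g (fun i => k * r i)) =
        unitCubeMeasure n (limsupStrip (fun _ => True) Q g r) := fun k hk => by
      rw [hmeas, hmeas]
      exact measure_congr (quasiMeasurePreserving_torusSection.preimage_ae_eq
        (limsupStrip_mul_ae_eq hQ hr hk))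
    refine ⟨fun k hk => ?_, heq⟩
    rw [heq k hk, hmeas]
    rcases eventuallyConst_set'.1 (eventuallyConst_preimage_limsupStrip (g := g) hQ hr)
      with h | h
    · left; rw [measure_congr h, measure_empty]
    · right
      rw [measure_congr h, ← preimage_univ (f := torusSection n),
        measurePreserving_torusSection.measure_preimage MeasurableSet.univ.nullMeasurableSet,
        measure_univ]
  · have huniv : ∀ k > 0, limsupStrip (fun _ => True) Q g (fun i => k * r i) = univ :=
      fun k hk => limsupStrip_eq_univ_of_not_tendsto hQ hr0 hfin hr hk
    have h1 : limsupStrip (fun _ => True) Q g r = univ := by simpa using huniv 1 one_pos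
    exact ⟨fun k hk => Or.inr (by rw [huniv k hk, measure_univ]),
      fun k hk => by rw [huniv k hk, h1]⟩

theorem finite_setOf_abs_add_intCast_le (v K : ℝ) : {p : ℤ | |v + p| ≤ K}.Finite := by
  refine (Set.finite_Icc ⌊-K - v⌋ ⌈K - v⌉).subset fun p hp => ?_
  rw [mem_ofPred_eq, abs_le] at hp
  obtain ⟨h1, h2⟩ := hp
  constructor
  · have := Int.floor_le (-K - v)
    exact_mod_cast this.trans (by linarith : -K - v ≤ p)
  · have := Int.le_ceil (K - v)
    exact_mod_cast (by linarith : (p : ℝ) ≤ K - v).trans this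

/-- Each factor is at least the positive distance from `v i` to the nearest integer, so a bound on
the product bounds every factor. -/
theorem finite_setOf_prod_abs_add_intCast_le {m : ℕ} {v : Fin m → ℝ}
    (hv : ∀ i, ∀ p : ℤ, v i + p ≠ 0) (K : ℝ) :
    {p : Fin m → ℤ | ∏ i, |v i + p i| ≤ K}.Finite := by
  set δ : Fin m → ℝ := fun i => |v i - round (v i)| with hδ
  have hδ0 : ∀ i, 0 < δ i := fun i => abs_pos.2 (by
    have := hv i (-round (v i))
    push_cast at this
    rwa [← sub_eq_add_neg] at this)
  have hle : ∀ i (p : ℤ), δ i ≤ |v i + p| := fun i p => by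
    have := round_le (v i) (-p)
    push_cast at this
    rwa [sub_neg_eq_add] at this
  refine (Set.Finite.pi' fun i => finite_setOf_abs_add_intCast_le (v i)
    (K / ∏ j ∈ Finset.univ.erase i, δ j)).subset fun p hp i => ?_
  have hD : 0 < ∏ j ∈ Finset.univ.erase i, δ j := Finset.prod_pos fun j _ => hδ0 j
  rw [mem_ofPred_eq, le_div_iff₀ hD]
  refine le_trans ?_ hp
  rw [← Finset.mul_prod_erase Finset.univ _ (Finset.mem_univ i)]
  gcongr with j
  exact hle j (p j)

theorem volume_setOf_sum_mul_add_eq_zero {q : Fin n → ℤ} (hq : q ≠ 0) (p : ℤ) :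
    volume {y : Fin n → ℝ | (∑ c, (q c : ℝ) * y c) + p = 0} = 0 := by
  set f : (Fin n → ℝ) →ₗ[ℝ] ℝ := ∑ c, (q c : ℝ) • LinearMap.proj c with hf
  have hfa : ∀ y, f y = ∑ c, (q c : ℝ) * y c := fun y => by simp [hf]
  rcases eq_empty_or_nonempty {y : Fin n → ℝ | (∑ c, (q c : ℝ) * y c) + p = 0} with h | ⟨x, hx⟩
  · rw [h, measure_empty]
  refine measure_mono_null (t := (AffineSubspace.mk' x f.ker : Set (Fin n → ℝ))) ?_
    (Measure.addHaar_affineSubspace _ _ ?_)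
  · intro y hy
    rw [SetLike.mem_coe, AffineSubspace.mem_mk', LinearMap.mem_ker, vsub_eq_sub, map_sub, hfa, hfa]
    rw [mem_ofPred_eq] at hx hy
    linarith
  · intro htop
    obtain ⟨c, hc⟩ := Function.ne_iff.1 hq
    have h1 : f.ker = ⊤ := by
      rw [← AffineSubspace.direction_mk' x f.ker, htop, AffineSubspace.direction_top]
    have h2 : f (Pi.single c 1) = 0 := by
      rw [← LinearMap.mem_ker, h1]; trivial
    rw [hfa, Finset.sum_eq_single c (fun c' _ hc' => by simp [hc']) (by simp)] at h2
    simp at h2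
    exact hc h2

theorem ae_forall_sum_mul_add_ne_zero (m : ℕ) :
    ∀ᵐ X ∂Measure.pi (fun _ : Fin m => unitCubeMeasure n),
      ∀ q : {q : Fin n → ℤ // q ≠ 0}, ∀ i, ∀ p : ℤ, (∑ c, (q.1 c : ℝ) * X i c) + p ≠ 0 := by
  simp only [ae_all_iff]
  intro q i p
  have h0 : ∀ᵐ y : Fin n → ℝ, (∑ c, (q.1 c : ℝ) * y c) + p ≠ 0 :=
    measure_eq_zero_iff_ae_notMem.1 (volume_setOf_sum_mul_add_eq_zero q.2 p)
  have h1 : ∀ᵐ y ∂unitCubeMeasure n, (∑ c, (q.1 c : ℝ) * y c) + p ≠ 0 := by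
    rw [unitCubeMeasure, ← Measure.restrict_pi_pi]
    exact ae_restrict_of_ae h0
  exact (Measure.quasiMeasurePreserving_eval (fun _ : Fin m => unitCubeMeasure n) i).ae h1

end Fibre

/-! ### From the multiplicative set to its fibres. -/

section Multiplicative

variable {n : ℕ}

/-- The other components of `p` enter only through their gcd. For `m = 0` this gcd is 0, which every
prime divides, leaving plain coprimality of `q` and `p j`. -/
theorem globallyCoprime_iff_coprimeTriple {m : ℕ} (q : Fin n → ℤ) (p : Fin (m + 1) → ℤ)
    (j : Fin (m + 1)) :
    GloballyCoprime q p ↔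
      CoprimeTriple q (p j) (Finset.univ.gcd fun i => p (j.succAbove i)) := by
  have hgcd : ∀ {k : ℕ} (v : Fin k → ℤ) (l : ℕ), (l : ℤ) ∣ Finset.univ.gcd v ↔ ∀ c, (l : ℤ) ∣ v c :=
    fun v l => by simp [Finset.dvd_gcd_iff]
  rw [GloballyCoprime, Nat.eq_one_iff_not_exists_prime_dvd]
  refine forall₂_congr fun l hl => ?_
  rw [← Int.natCast_dvd_natCast, Int.dvd_coe_gcd_iff, hgcd, hgcd, hgcd, Fin.forall_iff_succAbove j]
  tauto

/-- The set of all `X` for which the inequality defining `multiplicativeSetC` has infinitely many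
solutions, without the restriction to the unit cube. -/
def multiplicativeLimsup (n m : ℕ) (Ψ : {q : Fin n → ℤ // q ≠ 0} → ℝ) :
    Set (Fin m → Fin n → ℝ) :=
  {X | {qp : {q : Fin n → ℤ // q ≠ 0} × (Fin m → ℤ) |
      GloballyCoprime qp.1.1 qp.2 ∧
        ∏ j, |(∑ i, (qp.1.1 i : ℝ) * X j i) + (qp.2 j : ℝ)| < Ψ qp.1}.Infinite}

theorem measurableSet_multiplicativeLimsup (m : ℕ) (Ψ : {q : Fin n → ℤ // q ≠ 0} → ℝ) :
    MeasurableSet (multiplicativeLimsup n m Ψ) := by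
  refine measurableSet_setOf_infinite (U := fun qp : {q : Fin n → ℤ // q ≠ 0} × (Fin m → ℤ) =>
    {X : Fin m → Fin n → ℝ | GloballyCoprime qp.1.1 qp.2 ∧
        ∏ j, |(∑ i, (qp.1.1 i : ℝ) * X j i) + (qp.2 j : ℝ)| < Ψ qp.1}) fun qp => ?_
  have hc : Continuous fun X : Fin m → Fin n → ℝ =>
      ∏ j, |(∑ i, (qp.1.1 i : ℝ) * X j i) + (qp.2 j : ℝ)| := by fun_prop
  exact (MeasurableSet.const _).inter (isOpen_lt hc continuous_const).measurableSet

theorem volume_multiplicativeSetC (m : ℕ) (Ψ : {q : Fin n → ℤ // q ≠ 0} → ℝ) :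
    volume (multiplicativeSetC n m Ψ) =
      Measure.pi (fun _ : Fin m => unitCubeMeasure n) (multiplicativeLimsup n m Ψ) := by
  have h : multiplicativeSetC n m Ψ = multiplicativeLimsup n m Ψ ∩
      univ.pi fun _ => univ.pi fun _ => Icc (0 : ℝ) 1 := by
    ext X
    simp only [multiplicativeSetC, multiplicativeLimsup, mem_inter_iff, mem_ofPred_eq, Set.mem_pi,
      mem_univ, true_imp_iff]
    exact and_comm
  have hpi : (volume : Measure (Fin m → Fin n → ℝ)).restrict
      (univ.pi fun _ => univ.pi fun _ => Icc (0 : ℝ) 1) =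
      Measure.pi fun _ => unitCubeMeasure n := by
    rw [volume_pi, Measure.restrict_pi_pi]
    congr 1
    funext _
    rw [volume_pi, Measure.restrict_pi_pi]
    congr 1
    funext _
    exact Measure.restrict_congr_set Ioc_ae_eq_Icc.symm
  rw [h, ← Measure.restrict_apply (measurableSet_multiplicativeLimsup m Ψ), hpi]

/-- The width of the strips in the fibre of `multiplicativeLimsup` over fixed values `X` of all but
one of the `m + 1` vectors. -/
noncomputable def fibreWidth {m : ℕ} (Ψ : {q : Fin n → ℤ // q ≠ 0} → ℝ) (X : Fin m → Fin n → ℝ)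
    (i : {q : Fin n → ℤ // q ≠ 0} × (Fin m → ℤ)) : ℝ :=
  Ψ i.1 / ∏ l, |(∑ c, (i.1.1 c : ℝ) * X l c) + (i.2 l : ℝ)|

/-- The fibre of `multiplicativeLimsup` over fixed values `X` of all but one of the `m + 1`
vectors. -/
noncomputable def fibreLimsup {m : ℕ} (Ψ : {q : Fin n → ℤ // q ≠ 0} → ℝ) (X : Fin m → Fin n → ℝ)
    (k : ℝ) : Set (Fin n → ℝ) :=
  limsupStrip (fun _ => True) (fun i : {q : Fin n → ℤ // q ≠ 0} × (Fin m → ℤ) => i.1.1)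
    (fun i => Finset.univ.gcd i.2) (fun i => k * fibreWidth Ψ X i)

/-- Forgetting `p j` is finite-to-one on solutions, since `p j` is confined to a bounded interval
once `q` and the other components are fixed; infinitude is therefore preserved both ways. -/
theorem mem_multiplicativeLimsup_iff {m : ℕ} (j : Fin (m + 1)) (Y : Fin (m + 1) → Fin n → ℝ)
    (hY : ∀ q : {q : Fin n → ℤ // q ≠ 0}, ∀ i, ∀ p : ℤ,
      (∑ c, (q.1 c : ℝ) * Y (j.succAbove i) c) + p ≠ 0)
    (Ψ : {q : Fin n → ℤ // q ≠ 0} → ℝ) (k : ℝ) :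
    Y ∈ multiplicativeLimsup n (m + 1) (fun q => k * Ψ q) ↔
      Y j ∈ fibreLimsup Ψ (fun i => Y (j.succAbove i)) k := by
  set X : Fin m → Fin n → ℝ := fun i => Y (j.succAbove i) with hX
  set S := {qp : {q : Fin n → ℤ // q ≠ 0} × (Fin (m + 1) → ℤ) | GloballyCoprime qp.1.1 qp.2 ∧
    ∏ j, |(∑ i, (qp.1.1 i : ℝ) * Y j i) + (qp.2 j : ℝ)| < k * Ψ qp.1} with hS
  set f : {q : Fin n → ℤ // q ≠ 0} × (Fin (m + 1) → ℤ) →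
    {q : Fin n → ℤ // q ≠ 0} × (Fin m → ℤ) := fun qp => (qp.1, fun i => qp.2 (j.succAbove i)) with hf
  have hmem : ∀ qp, qp ∈ S ↔ CoprimeTriple qp.1.1 (qp.2 j) (Finset.univ.gcd (f qp).2) ∧
      |(∑ c, (qp.1.1 c : ℝ) * Y j c) + qp.2 j| < k * fibreWidth Ψ X (f qp) := by
    intro qp
    have hpos : 0 < ∏ l, |(∑ c, (qp.1.1 c : ℝ) * X l c) + ((f qp).2 l : ℝ)| :=
      Finset.prod_pos fun l _ => abs_pos.2 (hY qp.1 l _)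
    rw [hS, mem_ofPred_eq, globallyCoprime_iff_coprimeTriple _ _ j, Fin.prod_univ_succAbove _ j,
      fibreWidth, ← mul_div_assoc, lt_div_iff₀ hpos]
  have himg : {i : {q : Fin n → ℤ // q ≠ 0} × (Fin m → ℤ) | True ∧
      Y j ∈ coprimeStrip i.1.1 (Finset.univ.gcd i.2) (k * fibreWidth Ψ X i)} = f '' S := by
    ext i
    constructor
    · rintro ⟨-, a, ha, hlt⟩
      have hfi : f (i.1, j.insertNth a i.2) = i := by simp [hf]
      refine ⟨(i.1, j.insertNth a i.2), (hmem _).2 ?_, hfi⟩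
      rw [hfi]
      simpa using ⟨ha, hlt⟩
    · rintro ⟨qp, hqp, rfl⟩
      exact ⟨trivial, qp.2 j, (hmem qp).1 hqp⟩
  change S.Infinite ↔ Set.Infinite _
  rw [himg]
  refine ⟨fun h => ?_, Infinite.of_image f⟩
  contrapose! h
  refine Set.Finite.of_finite_fibers f h fun i _ => ?_
  refine ((finite_setOf_abs_add_intCast_le (∑ c, (i.1.1 c : ℝ) * Y j c)
    (k * fibreWidth Ψ X i)).image
    (fun a : ℤ => (i.1, (j.insertNth a i.2 : Fin (m + 1) → ℤ)))).subset ?_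
  rintro qp ⟨hqp, rfl⟩
  refine ⟨qp.2 j, ((hmem qp).1 hqp).2.le, Prod.ext rfl ?_⟩
  simp only [hf]
  rw [Fin.insertNth_eq_iff]
  exact ⟨rfl, rfl⟩

theorem unitCubeMeasure_fibreLimsup {m : ℕ} {Ψ : {q : Fin n → ℤ // q ≠ 0} → ℝ}
    (hΨ : ∀ q, 0 ≤ Ψ q) {X : Fin m → Fin n → ℝ}
    (hX : ∀ q : {q : Fin n → ℤ // q ≠ 0}, ∀ i, ∀ p : ℤ, (∑ c, (q.1 c : ℝ) * X i c) + p ≠ 0) :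
    (∀ k > 0, unitCubeMeasure n (fibreLimsup Ψ X k) = 0 ∨
      unitCubeMeasure n (fibreLimsup Ψ X k) = 1) ∧
    ∀ k > 0, ∀ k' > 0, unitCubeMeasure n (fibreLimsup Ψ X k) =
      unitCubeMeasure n (fibreLimsup Ψ X k') := by
  have hpos : ∀ i : {q : Fin n → ℤ // q ≠ 0} × (Fin m → ℤ),
      0 < ∏ l, |(∑ c, (i.1.1 c : ℝ) * X l c) + (i.2 l : ℝ)| := fun i =>
    Finset.prod_pos fun l _ => abs_pos.2 (hX i.1 l _)
  have h := unitCubeMeasure_limsupStrip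
    (Q := fun i : {q : Fin n → ℤ // q ≠ 0} × (Fin m → ℤ) => i.1.1)
    (g := fun i => Finset.univ.gcd i.2) (r := fibreWidth Ψ X) (fun i => i.1.2)
    (fun i => div_nonneg (hΨ _) (hpos i).le) (fun q ε hε => ?_)
  · exact ⟨h.1, fun k hk k' hk' => (h.2 k hk).trans (h.2 k' hk').symm⟩
  · by_cases hq : q = 0
    · convert! Set.finite_empty
      exact eq_empty_of_forall_notMem fun i hi => i.1.2 (hi.1.trans hq)
    · refine ((finite_setOf_prod_abs_add_intCast_le (v := fun l => ∑ c, (q c : ℝ) * X l c)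
        (fun l p => hX ⟨q, hq⟩ l p) (Ψ ⟨q, hq⟩ / ε)).image
        (fun p => ((⟨q, hq⟩ : {q : Fin n → ℤ // q ≠ 0}), p))).subset ?_
      rintro ⟨⟨q', hq'⟩, p⟩ ⟨rfl, hi⟩
      refine ⟨p, ?_, rfl⟩
      have := hpos (⟨q', hq'⟩, p)
      rw [fibreWidth, le_div_iff₀ this] at hi
      rw [mem_ofPred_eq, le_div_iff₀ hε, mul_comm]
      exact hi

theorem update_mem_multiplicativeLimsup_iff {m : ℕ} (j : Fin (m + 1))
    (Y : Fin (m + 1) → Fin n → ℝ)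
    (hY : ∀ q : {q : Fin n → ℤ // q ≠ 0}, ∀ i, ∀ p : ℤ, (∑ c, (q.1 c : ℝ) * Y i c) + p ≠ 0)
    (Ψ : {q : Fin n → ℤ // q ≠ 0} → ℝ) (k : ℝ) (y : Fin n → ℝ) :
    Function.update Y j y ∈ multiplicativeLimsup n (m + 1) (fun q => k * Ψ q) ↔
      y ∈ fibreLimsup Ψ (fun i => Y (j.succAbove i)) k := by
  have h : ∀ i, Function.update Y j y (j.succAbove i) = Y (j.succAbove i) := fun i =>
    Function.update_of_ne (Fin.succAbove_ne j i) _ _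
  rw [mem_multiplicativeLimsup_iff j _ (fun q i p => by rw [h]; exact hY q _ p)]
  simp only [h, Function.update_self]

theorem measure_multiplicativeLimsup_eq_lintegral (m : ℕ) (Ψ : {q : Fin n → ℤ // q ≠ 0} → ℝ)
    (k : ℝ) :
    Measure.pi (fun _ : Fin (m + 1) => unitCubeMeasure n)
        (multiplicativeLimsup n (m + 1) fun q => k * Ψ q) =
      ∫⁻ X, unitCubeMeasure n (fibreLimsup Ψ X k)
        ∂Measure.pi (fun _ : Fin m => unitCubeMeasure n) := by
  have hmp := (measurePreserving_piFinSuccAbove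
    (fun _ : Fin (m + 1) => unitCubeMeasure n) 0).symm
  have hE := measurableSet_multiplicativeLimsup (m + 1) fun q => k * Ψ q
  rw [← hmp.measure_preimage hE.nullMeasurableSet, Measure.prod_apply_symm (hmp.measurable hE)]
  refine lintegral_congr_ae ?_
  filter_upwards [ae_forall_sum_mul_add_ne_zero m] with X hX
  congr 1
  ext y
  have he : (MeasurableEquiv.piFinSuccAbove (fun _ : Fin (m + 1) => Fin n → ℝ) 0).symm (y, X) =
      Fin.cons y X := by simp [Fin.consEquiv]
  simp only [mem_preimage, he]
  rw [mem_multiplicativeLimsup_iff 0 _ (by simpa using hX)]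
  simp

end Multiplicative

theorem theorem4p1 (n m : ℕ) (hn : 1 ≤ n) (hm : 1 ≤ m)
    (Ψ : {q : Fin n → ℤ // q ≠ 0} → ℝ) (hΨ : ∀ q, 0 ≤ Ψ q) :
    (∀ k : ℝ, 0 < k →
      MeasureTheory.volume (multiplicativeSetC n m (fun q => k * Ψ q)) = 0 ∨
        MeasureTheory.volume (multiplicativeSetC n m (fun q => k * Ψ q)) = 1) ∧
    (∀ k k' : ℝ, 0 < k → 0 < k' →
      MeasureTheory.volume (multiplicativeSetC n m (fun q => k * Ψ q)) =
        MeasureTheory.volume (multiplicativeSetC n m (fun q => k' * Ψ q))) := by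
  obtain ⟨m, rfl⟩ := Nat.exists_eq_add_of_le' hm
  simp only [volume_multiplicativeSetC]
  refine ⟨fun k hk => ?_, fun k k' hk hk' => ?_⟩
  · refine measure_pi_eq_zero_or_one_of_update _ _
      (measurableSet_multiplicativeLimsup _ _) fun j => ?_
    filter_upwards [ae_forall_sum_mul_add_ne_zero (m + 1)] with Y hY
    simp only [update_mem_multiplicativeLimsup_iff j Y hY]
    exact (unitCubeMeasure_fibreLimsup hΨ fun q i p => hY q _ p).1 k hk
  · rw [measure_multiplicativeLimsup_eq_lintegral, measure_multiplicativeLimsup_eq_lintegral]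
    refine lintegral_congr_ae ?_
    filter_upwards [ae_forall_sum_mul_add_ne_zero m] with X hX
    exact (unitCubeMeasure_fibreLimsup hΨ hX).2 k hk k' hk'
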